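/- Let $n\ge 1$, let $\mathbb{B}_n=\{z\in\mathbb{C}^n:|z|<1\}$, let $\langle z,w\rangle=\sum_k z_k\overline{w_k}$, and let $v$ be Lebesgue measure on $\mathbb{B}_n$ normalized so that $v(\mathbb{B}_n)=1$. For $\alpha>-1$ put $$dv_\alpha(z)=c_\alpha(1-|z|^2)^\alpha\,dv(z),\qquad c_\alpha=\frac{\Gamma(n+\alpha+1)}{n!\,\Gamma(\alpha+1)},$$ and for $0<p<\infty$ put $\|g\|_{p,\alpha}=\left(\int_{\mathbb{B}_n}|g|^p\,dv_\alpha\right)^{1/p}\in[0,\infty]$. The Bergman space $\mathcal{A}^p_\alpha$ consists of the holomorphic functions $f$ on $\mathbb{B}_n$ with $\|f\|_{p,\alpha}<\infty$. Let $$\beta(z,w)=\frac12\log\frac{1+|\varphi_z(w)|}{1-|\varphi_z(w)|}\qquad(z,w\in\mathbb{B}_n)$$ be the Bergman metric, where $\varphi_z$ is the involutive automorphism of $\mathbb{B}_n$ that exchanges $0$ and $z$, namely $$\varphi_z(w)=\frac{z-P_zw-\sqrt{1-|z|^2}\,(w-P_zw)}{1-\langle w,z\rangle},$$ with $P_z$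 the orthogonal projection of $\mathbb{C}^n$ onto the span of $z$. For $\gamma>0$ let $D(z,\gamma)=\{w\in\mathbb{B}_n:\beta(z,w)<\gamma\}$, and for $f$ holomorphic on $\mathbb{B}_n$ let $$(\mathrm{M}_\gamma f)(z)=\sup_{w\in D(z,\gamma)}|f(w)|,\qquad z\in\mathbb{B}_n.$$ **Theorem.** Let $\gamma>0$, $\alpha>-1$ and $0<p<\infty$. A holomorphic function $f$ on $\mathbb{B}_n$ belongs to $\mathcal{A}^p_\alpha$ if and only if $\mathrm{M}_\gamma f\in L^p(\mathbb{B}_n,dv_\alpha)$. Moreover, there is a constant $C>0$, depending only on $\gamma,\alpha,p,n$, such that for every holomorphic function $f$ on $\mathbb{B}_n$ $$\|f\|_{p,\alpha}\le C\,\|\mathrm{M}_\gamma f\|_{p,\alpha}\quad\text{and}\quad\|\mathrm{M}_\gamma f\|_{p,\alpha}\le C\,\|f\|_{p,\alpha}$$ (the quantities may be infinite). -/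

import Mathlib

open MeasureTheory
open scoped ENNReal NNReal

noncomputable section

namespace BergmanBall

/-- The space `ℂⁿ` with its Euclidean norm. -/
abbrev Cn (n : ℕ) : Type := EuclideanSpace ℂ (Fin n)

/-- The open unit ball `𝔹_n` of `ℂⁿ`. -/
def unitBall (n : ℕ) : Set (Cn n) := Metric.ball 0 1

/-- The Hermitian product `⟨z, w⟩ = z₁ w̄₁ + ⋯ + z_n w̄_n`, linear in the first variable. -/
def herm {n : ℕ} (z w : Cn n) : ℂ := ∑ k, z k * (starRingEnd ℂ) (w k)

/-- The space `H(𝔹_n)` of holomorphic functions on the unit ball; a function on the ball is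
represented by a function on `ℂⁿ`, whose values off the ball play no role. -/
def holomorphic (n : ℕ) : Set (Cn n → ℂ) := {f | DifferentiableOn ℂ f (unitBall n)}

/-- Lebesgue measure on the unit ball, normalized to have total mass one. -/
def normalizedVolume (n : ℕ) : Measure (Cn n) :=
  (volume (unitBall n))⁻¹ • volume.restrict (unitBall n)

/-- The constant `c_α = Γ(n + α + 1) / (n! Γ(α + 1))`, for `α > -1`. -/
def weightConst (n : ℕ) (α : ℝ) : ℝ :=
  Real.Gamma (n + α + 1) / ((Nat.factorial n : ℝ) * Real.Gamma (α + 1))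

/-- The weighted measure `dv_α(z) = c_α (1 - |z|²)^α dv(z)` on the unit ball, for `α > -1`. -/
def weightedMeasure (n : ℕ) (α : ℝ) : Measure (Cn n) :=
  (normalizedVolume n).withDensity
    fun z => ENNReal.ofReal (weightConst n α * (1 - ‖z‖ ^ 2) ^ α)

/-- `‖g‖_{p,α} = (∫ |g|^p dv_α)^{1/p}`, a possibly infinite quantity, for `0 < p < ∞`. -/
def weightedNorm {n : ℕ} {F : Type*} [ENorm F] (p α : ℝ) (g : Cn n → F) : ℝ≥0∞ :=
  (∫⁻ z, ‖g z‖ₑ ^ p ∂(weightedMeasure n α)) ^ (1 / p)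

/-- The weighted Bergman space `A^p_α`: the holomorphic functions on the unit ball with
`‖f‖_{p,α} < ∞`. -/
def bergmanSpace (n : ℕ) (p α : ℝ) : Set (Cn n → ℂ) :=
  {f | f ∈ holomorphic n ∧ weightedNorm p α f < ∞}

/-- The orthogonal projection `P_a` of `ℂⁿ` onto the complex line spanned by `a`
(with `P_0 = 0`). -/
def lineProj {n : ℕ} (a w : Cn n) : Cn n := (herm w a / (‖a‖ : ℂ) ^ 2) • a

/-- The involutive automorphism `φ_a` of the unit ball that exchanges `0` and `a`:
`φ_a(w) = (a - P_a w - (1 - |a|²)^{1/2} (w - P_a w)) / (1 - ⟨w, a⟩)`. -/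
def involution {n : ℕ} (a w : Cn n) : Cn n :=
  (1 - herm w a)⁻¹ •
    (a - lineProj a w - ((Real.sqrt (1 - ‖a‖ ^ 2) : ℝ) : ℂ) • (w - lineProj a w))

/-- The Bergman metric `β(z, w) = (1/2) log ((1 + |φ_z(w)|) / (1 - |φ_z(w)|))`
on the unit ball. -/
def bergmanDist {n : ℕ} (z w : Cn n) : ℝ :=
  (1 / 2) * Real.log ((1 + ‖involution z w‖) / (1 - ‖involution z w‖))

/-- The Bergman metric ball `D(z, γ)`. -/
def bergmanMetricBall {n : ℕ} (z : Cn n) (γ : ℝ) : Set (Cn n) :=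
  {w | w ∈ unitBall n ∧ bergmanDist z w < γ}

/-- The maximal function `(M_γ f)(z) = sup_{w ∈ D(z, γ)} |f(w)|`, with values in `[0, ∞]`. -/
def maximalFunction {n : ℕ} (γ : ℝ) (f : Cn n → ℂ) (z : Cn n) : ℝ≥0∞ :=
  ⨆ w ∈ bergmanMetricBall z γ, ‖f w‖ₑ

end BergmanBall

end

/-! One inequality is pointwise: z lies in D(z, γ), so |f| ≤ M_γ f on the ball. For the other,
|f(w)|^p with w ∈ D(z, γ) is bounded by a mean of |f|^p at the Bergman scale around w, and the bound
is integrated in z.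

The mean value inequality `rpow_enorm_mul_volume_le` holds for every p > 0 on any measurable set in
the domain that is circular about w; it comes from Jensen's formula on complex discs centred at w.
Bergman balls are in general not circular about their centres, so `ellipsoid w r` replaces them; its
volume is a constant times (1 - |w|²)^(n+1) (`volume_ellipsoid`).

The quasi-triangle inequality for |1 - ⟨z, w⟩| shows that points u of the ellipsoid stay near z,
with 1 - |u|² comparable to 1 - |z|² (`mem_nearPairs`). Hence M_γ f(z)^p (1 - |z|²)^α is at most a
constant times the integral of |f(u)|^p (1 - |u|²)^(α-n-1) over u near z. After Tonelli, the z near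
a given u lie in an ellipsoid about u, whose volume cancels the factor (1 - |u|²)^(-n-1). -/

noncomputable section

namespace BergmanBall

/-! ### Sub-mean value property of |f|^p -/

section

open Metric Real

/-- The average over the unit circle of `log ‖g‖` dominates its value at the center. -/
theorem log_norm_le_circleAverage {g : ℂ → ℂ} (hg : AnalyticOnNhd ℂ g (closedBall 0 1))
    (h0 : g 0 ≠ 0) : log ‖g 0‖ ≤ circleAverage (fun z => log ‖g z‖) 0 1 := by
  have hg' : AnalyticOnNhd ℂ g (closedBall 0 |(1 : ℝ)|) := by simpa using hg
  have key := hg'.circleAverage_log_norm one_ne_zero h0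
  rw [key]
  -- The correction in Jensen's formula is nonnegative: g has zeros but no poles, and log(1/|u|) ≥ 0
  -- for |u| ≤ 1.
  have : 0 ≤ ∑ᶠ u, (MeromorphicOn.divisor g (closedBall 0 |(1 : ℝ)|) u : ℝ) *
      log (1 * ‖(0 : ℂ) - u‖⁻¹) := by
    refine finsum_nonneg fun u => ?_
    by_cases hu : u ∈ closedBall (0 : ℂ) |(1 : ℝ)|
    · refine mul_nonneg ?_ ?_
      · exact_mod_cast MeromorphicOn.AnalyticOnNhd.divisor_nonneg hg' u
      · rw [one_mul, log_inv, neg_nonneg]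
        refine log_nonpos (norm_nonneg _) ?_
        simpa using hu
    · simp [Function.locallyFinsuppWithin.apply_eq_zero_of_notMem _ hu]
  linarith

/-- Tangent line bound for the exponential, in multiplicative form. -/
theorem rpow_mul_one_add_log_le {a b p : ℝ} (ha : 0 < a) (hb : 0 < b) :
    a ^ p * (1 + p * (log b - log a)) ≤ b ^ p := by
  have h := add_one_le_exp (p * (log b - log a))
  have : b ^ p = a ^ p * exp (p * (log b - log a)) := by
    rw [rpow_def_of_pos hb, rpow_def_of_pos ha, ← exp_add]
    ring_nf
  rw [this]
  gcongr
  linarith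

/-- The sub-mean value property of `‖g‖ ^ p` on the unit circle. -/
theorem rpow_norm_le_circleAverage {g : ℂ → ℂ} {p : ℝ} (hp : 0 < p)
    (hg : AnalyticOnNhd ℂ g (closedBall 0 1)) :
    ‖g 0‖ ^ p ≤ circleAverage (fun z => ‖g z‖ ^ p) 0 1 := by
  have hN : CircleIntegrable (fun z => ‖g z‖ ^ p) 0 1 := by
    refine ContinuousOn.circleIntegrable zero_le_one ?_
    exact ((hg.continuousOn.mono sphere_subset_closedBall).norm).rpow_const
      fun _ _ => Or.inr hp.le
  by_cases h0 : g 0 = 0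
  · rw [h0, norm_zero, zero_rpow hp.ne']
    exact circleAverage_nonneg_of_nonneg fun z _ => by positivity
  set A := ‖g 0‖ ^ p with hA
  have hg0 : 0 < ‖g 0‖ := norm_pos_iff.mpr h0
  have hlog : CircleIntegrable (fun z => log ‖g z‖) 0 1 :=
    MeromorphicOn.circleIntegrable_log_norm
      ((hg.mono (by simpa using sphere_subset_closedBall)).meromorphicOn)
  set c₀ := A * (1 - p * log ‖g 0‖) with hc₀
  set L : ℂ → ℝ := fun z => c₀ + (A * p) • log ‖g z‖ with hL
  have hLi : CircleIntegrable L 0 1 :=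
    (circleIntegrable_const c₀ 0 1).add (hlog.const_fun_smul)
  have hLavg : circleAverage L 0 1 = c₀ + (A * p) * circleAverage (fun z => log ‖g z‖) 0 1 := by
    rw [hL, circleAverage_fun_add (circleIntegrable_const c₀ 0 1) hlog.const_fun_smul,
      circleAverage_const, circleAverage_fun_smul, smul_eq_mul]
  -- The tangent line bound L ≤ ‖g‖ ^ p can fail at zeros of g, where `log 0 = 0`. Taking the
  -- minimum repairs this on a discrete set, without changing the circle average.
  have hEq : L =ᶠ[Filter.codiscreteWithin (sphere 0 |(1 : ℝ)|)]
      fun z => min (L z) (‖g z‖ ^ p) := by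
    have hz := hg.preimage_zero_mem_codiscreteWithin h0 (by simp)
      ((convex_closedBall (0 : ℂ) 1).isConnected (by simp))
    have := Filter.codiscreteWithin_mono (by simpa using sphere_subset_closedBall :
      sphere (0 : ℂ) |(1 : ℝ)| ⊆ closedBall 0 1) hz
    filter_upwards [this] with z hz
    have hgz : 0 < ‖g z‖ := norm_pos_iff.mpr hz
    refine (min_eq_left ?_).symm
    have := rpow_mul_one_add_log_le (p := p) hg0 hgz
    simp only [hL, hc₀, smul_eq_mul]
    linarith
  have h1 := circleAverage_congr_codiscreteWithin hEq one_ne_zero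
  have h2 : circleAverage (fun z => min (L z) (‖g z‖ ^ p)) 0 1 ≤
      circleAverage (fun z => ‖g z‖ ^ p) 0 1 :=
    circleAverage_mono (hLi.congr_codiscreteWithin hEq) hN fun _ _ => min_le_right _ _
  have h3 := log_norm_le_circleAverage hg h0
  have hA0 : 0 ≤ A * p := by positivity
  nlinarith [mul_le_mul_of_nonneg_left h3 hA0]

/-- The sub-mean value property of `‖g‖ ^ p` on the unit circle, as a lower integral. -/
theorem rpow_enorm_mul_le_lintegral_circle {g : ℂ → ℂ} {p : ℝ} (hp : 0 < p)
    (hg : AnalyticOnNhd ℂ g (closedBall 0 1)) :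
    ‖g 0‖ₑ ^ p * ENNReal.ofReal (2 * π) ≤
      ∫⁻ θ in Set.Ioc 0 (2 * π), ‖g (circleMap 0 1 θ)‖ₑ ^ p := by
  have h := rpow_norm_le_circleAverage hp hg
  have hcont : Continuous fun θ : ℝ => ‖g (circleMap 0 1 θ)‖ ^ p := by
    refine Continuous.rpow_const (Continuous.norm ?_) fun _ => Or.inr hp.le
    exact hg.continuousOn.comp_continuous (continuous_circleMap 0 1) fun θ => by
      simp
  have h2 : ‖g 0‖ ^ p * (2 * π) ≤ ∫ θ in Set.Ioc 0 (2 * π), ‖g (circleMap 0 1 θ)‖ ^ p := by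
    rw [circleAverage_def, smul_eq_mul, intervalIntegral.integral_of_le two_pi_pos.le] at h
    rwa [inv_mul_eq_div, le_div_iff₀ two_pi_pos] at h
  have he : ∀ x : ℂ, ‖x‖ₑ ^ p = ENNReal.ofReal (‖x‖ ^ p) := fun x => by
    rw [← ofReal_norm, ENNReal.ofReal_rpow_of_nonneg (norm_nonneg _) hp.le]
  simp_rw [he]
  rw [← ofReal_integral_eq_lintegral_ofReal
    ((hcont.continuousOn.integrableOn_Icc).mono_set Set.Ioc_subset_Icc_self)
    (Filter.Eventually.of_forall fun θ => by positivity),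
    ← ENNReal.ofReal_mul (by positivity)]
  exact ENNReal.ofReal_le_ofReal h2

/-- Rotations about a point of `ℂⁿ` preserve Lebesgue measure. -/
theorem measurePreserving_rotate {n : ℕ} (w : Cn n) {c : ℂ} (hc : ‖c‖ = 1) :
    MeasurePreserving (fun x : Cn n => w + c • (x - w)) volume volume := by
  have hc0 : c ≠ 0 := fun h => by simp [h] at hc
  let e : Cn n ≃ₗᵢ[ℝ] Cn n :=
    { (LinearEquiv.smulOfNeZero ℂ (Cn n) c hc0).restrictScalars ℝ with
      norm_map' := fun x => by
        change ‖c • x‖ = ‖x‖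
        rw [norm_smul, hc, one_mul] }
  exact (measurePreserving_add_left volume w).comp
    (e.measurePreserving.comp (measurePreserving_sub_right volume w))

/-- The function `‖f‖ ^ p`, extended by zero, is measurable if `f` is continuous on the set. -/
theorem measurable_indicator_rpow_enorm {n : ℕ} {f : Cn n → ℂ} {S : Set (Cn n)} (p : ℝ)
    (hS : MeasurableSet S) (hf : ContinuousOn f S) :
    Measurable (S.indicator fun x => ‖f x‖ₑ ^ p) := by
  classical
  have h : Measurable (S.piecewise f 0) := hf.measurable_piecewise continuousOn_const hS
  have : (S.indicator fun x => ‖f x‖ₑ ^ p) =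
      S.indicator fun x => ‖S.piecewise f 0 x‖ₑ ^ p := by
    refine Set.indicator_congr fun x hx => ?_
    rw [Set.piecewise_eq_of_mem _ _ _ hx]
  rw [this]
  exact (h.enorm.pow_const p).indicator hS

/-- The sub-mean value property of `‖f‖ ^ p` on a measurable set that is circular about `w`. -/
theorem rpow_enorm_mul_volume_le {n : ℕ} {f : Cn n → ℂ} {U S : Set (Cn n)} {p : ℝ} (hp : 0 < p)
    (hU : IsOpen U) (hf : DifferentiableOn ℂ f U) (hS : MeasurableSet S) (hSU : S ⊆ U) {w : Cn n}
    (hw : ∀ x ∈ S, ∀ c : ℂ, ‖c‖ ≤ 1 → w + c • (x - w) ∈ S) :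
    ‖f w‖ₑ ^ p * volume S ≤ ∫⁻ x in S, ‖f x‖ₑ ^ p := by
  set F : Cn n → ℝ≥0∞ := S.indicator fun x => ‖f x‖ₑ ^ p with hF
  have hFm : Measurable F := measurable_indicator_rpow_enorm p hS (hf.continuousOn.mono hSU)
  have hrot : ∀ θ : ℝ, ∫⁻ x, F (w + circleMap 0 1 θ • (x - w)) = ∫⁻ x, F x := fun θ =>
    (measurePreserving_rotate w (by simp)).lintegral_comp hFm
  have hpi : ENNReal.ofReal (2 * π) ≠ 0 := by simpa using two_pi_pos
  have hmeas : Measurable (Function.uncurry fun (θ : ℝ) (x : Cn n) =>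
      F (w + circleMap 0 1 θ • (x - w))) := by
    refine hFm.comp (Continuous.measurable ?_)
    have := continuous_circleMap 0 1
    fun_prop
  -- Each rotation about w preserves ∫ F, so averaging over rotations reduces the claim to the
  -- circles c ↦ w + c (x - w), |c| = 1.
  have hswap : ENNReal.ofReal (2 * π) * ∫⁻ x, F x =
      ∫⁻ x, ∫⁻ θ in Set.Ioc 0 (2 * π), F (w + circleMap 0 1 θ • (x - w)) := by
    rw [← lintegral_lintegral_swap hmeas.aemeasurable]
    simp_rw [hrot]
    simp [mul_comm]
  have hpt : ∀ x ∈ S, ‖f w‖ₑ ^ p * ENNReal.ofReal (2 * π) ≤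
      ∫⁻ θ in Set.Ioc 0 (2 * π), F (w + circleMap 0 1 θ • (x - w)) := by
    intro x hx
    have han : AnalyticOnNhd ℂ (fun c : ℂ => f (w + c • (x - w))) (closedBall 0 1) := by
      have hV : IsOpen ((fun c : ℂ => w + c • (x - w)) ⁻¹' U) :=
        hU.preimage (by fun_prop)
      refine (DifferentiableOn.analyticOnNhd (s := (fun c : ℂ => w + c • (x - w)) ⁻¹' U)
        ?_ hV).mono ?_
      · exact hf.comp (by fun_prop) fun c hc => hc
      · intro c hc
        exact hSU (hw x hx c (by simpa using hc))
    refine (rpow_enorm_mul_le_lintegral_circle (g := fun c : ℂ => f (w + c • (x - w))) hp han).trans'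
      (by simp) |>.trans (le_of_eq ?_)
    refine lintegral_congr fun θ => ?_
    rw [hF, Set.indicator_of_mem (hw x hx _ (by simp))]
  have : ENNReal.ofReal (2 * π) * (‖f w‖ₑ ^ p * volume S) ≤
      ENNReal.ofReal (2 * π) * ∫⁻ x in S, ‖f x‖ₑ ^ p := by
    rw [← lintegral_indicator hS, hswap]
    calc ENNReal.ofReal (2 * π) * (‖f w‖ₑ ^ p * volume S)
        = ∫⁻ _ in S, ‖f w‖ₑ ^ p * ENNReal.ofReal (2 * π) := by
          rw [setLIntegral_const]; ring
      _ ≤ ∫⁻ x in S, ∫⁻ θ in Set.Ioc 0 (2 * π), F (w + circleMap 0 1 θ • (x - w)) :=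
          setLIntegral_mono' hS hpt
      _ ≤ _ := setLIntegral_le_lintegral _ _
  exact (ENNReal.mul_le_mul_iff_right hpi ENNReal.ofReal_ne_top).1 this

end

/-! ### The Hermitian product and Bergman balls -/

theorem herm_eq_inner {n : ℕ} (z w : Cn n) : herm z w = inner ℂ w z := by
  simp [herm, PiLp.inner_apply]

theorem norm_herm_le {n : ℕ} (z w : Cn n) : ‖herm z w‖ ≤ ‖z‖ * ‖w‖ := by
  rw [herm_eq_inner, mul_comm]
  exact norm_inner_le_norm w z

theorem herm_sub_left {n : ℕ} (x y w : Cn n) : herm (x - y) w = herm x w - herm y w := by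
  simp only [herm_eq_inner, inner_sub_right]

theorem herm_sub_right {n : ℕ} (x y w : Cn n) : herm w (x - y) = herm w x - herm w y := by
  simp only [herm_eq_inner, inner_sub_left]

theorem herm_smul_left {n : ℕ} (c : ℂ) (x w : Cn n) : herm (c • x) w = c * herm x w := by
  simp only [herm_eq_inner, inner_smul_right]

theorem herm_self {n : ℕ} (z : Cn n) : herm z z = (‖z‖ : ℂ) ^ 2 := by
  rw [herm_eq_inner, inner_self_eq_norm_sq_to_K]
  rfl

theorem norm_one_sub_herm_comm {n : ℕ} (z w : Cn n) : ‖1 - herm z w‖ = ‖1 - herm w z‖ := by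
  rw [herm_eq_inner, herm_eq_inner, ← inner_conj_symm, ← RCLike.norm_conj]
  simp

theorem norm_sub_sq_eq {n : ℕ} (z w : Cn n) :
    ‖z - w‖ ^ 2 = ‖z‖ ^ 2 - 2 * (herm z w).re + ‖w‖ ^ 2 := by
  rw [herm_eq_inner, @norm_sub_sq ℂ, inner_re_symm]
  rfl

@[fun_prop]
theorem continuous_herm {n : ℕ} {X : Type*} [TopologicalSpace X] {a b : X → Cn n}
    (ha : Continuous a) (hb : Continuous b) : Continuous fun x => herm (a x) (b x) := by
  simp only [herm_eq_inner]
  exact hb.inner ha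

theorem mem_unitBall_iff {n : ℕ} {z : Cn n} : z ∈ unitBall n ↔ 0 < 1 - ‖z‖ ^ 2 := by
  rw [unitBall, mem_ball_zero_iff, sub_pos, sq_lt_one_iff_abs_lt_one, abs_norm]

theorem norm_sub_sq_le {n : ℕ} {z w : Cn n} (hz : z ∈ unitBall n) (hw : w ∈ unitBall n) :
    ‖z - w‖ ^ 2 ≤ 2 * ‖1 - herm z w‖ := by
  rw [mem_unitBall_iff] at hz hw
  have := Complex.re_le_norm (1 - herm z w)
  rw [norm_sub_sq_eq]
  simp only [Complex.sub_re, Complex.one_re] at this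
  linarith

theorem one_sub_norm_sq_le {n : ℕ} {z w : Cn n} (hz : z ∈ unitBall n) (hw : w ∈ unitBall n) :
    1 - ‖z‖ ^ 2 ≤ 2 * ‖1 - herm z w‖ := by
  rw [unitBall, mem_ball_zero_iff] at hz hw
  have h1 := norm_sub_norm_le (1 : ℂ) (herm z w)
  rw [norm_one] at h1
  nlinarith [norm_herm_le z w, norm_nonneg z, norm_nonneg w]

/-- The quasi-triangle inequality for `|1 - ⟨z, w⟩|` on the unit ball. -/
theorem norm_one_sub_herm_le {n : ℕ} {z w u : Cn n} (hz : z ∈ unitBall n) (hw : w ∈ unitBall n)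
    (hu : u ∈ unitBall n) :
    ‖1 - herm z w‖ ≤ 4 * (‖1 - herm z u‖ + ‖1 - herm u w‖) := by
  have h1 : 1 - herm z w = (1 - herm z u) + (1 - herm u w) - ((1 - ‖u‖ ^ 2 : ℝ) : ℂ) -
      herm (z - u) (w - u) := by
    rw [herm_sub_left, herm_sub_right, herm_sub_right, herm_self]
    push_cast
    ring
  have h2 : ‖1 - herm z w‖ ≤ ‖1 - herm z u‖ + ‖1 - herm u w‖ + (1 - ‖u‖ ^ 2) +
      ‖z - u‖ * ‖w - u‖ := by
    rw [h1]
    refine (norm_sub_le _ _).trans (add_le_add ((norm_sub_le _ _).trans (add_le_add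
      (norm_add_le _ _) ?_)) (norm_herm_le _ _))
    rw [Complex.norm_real, Real.norm_of_nonneg (mem_unitBall_iff.1 hu).le]
  have h3 := norm_sub_sq_le hz hu
  have h4 := norm_sub_sq_le hw hu
  have h5 := one_sub_norm_sq_le hu hz
  rw [norm_one_sub_herm_comm] at h4 h5
  -- With a = |1 - ⟨z, u⟩| and b = |1 - ⟨u, w⟩|: 1 - |u|² ≤ 2a and, by AM-GM, |z - u| |w - u| ≤ a +
  -- b, for a total of 4a + 2b.
  nlinarith [sq_nonneg (‖z - u‖ - ‖w - u‖), norm_nonneg (1 - herm u w)]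

/-- The identity behind `1 - |φ_z(w)|² = (1 - |z|²)(1 - |w|²) / |1 - ⟨w, z⟩|²`. -/
theorem norm_involution_sq_mul {n : ℕ} {z w : Cn n} (hz : z ∈ unitBall n)
    (hw : w ∈ unitBall n) :
    ‖involution z w‖ ^ 2 * ‖1 - herm w z‖ ^ 2 =
      ‖1 - herm w z‖ ^ 2 - (1 - ‖z‖ ^ 2) * (1 - ‖w‖ ^ 2) := by
  have hne : ‖1 - herm w z‖ ≠ 0 := by
    have := one_sub_norm_sq_le hw hz
    have := mem_unitBall_iff.1 hw
    intro h
    linarith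
  have hz' := mem_unitBall_iff.1 hz
  have hnum : ‖z - lineProj z w - ((Real.sqrt (1 - ‖z‖ ^ 2) : ℝ) : ℂ) • (w - lineProj z w)‖ ^ 2 =
      ‖1 - herm w z‖ ^ 2 - (1 - ‖z‖ ^ 2) * (1 - ‖w‖ ^ 2) := by
    have hexp : ‖1 - herm w z‖ ^ 2 = 1 - 2 * (herm w z).re + ‖herm w z‖ ^ 2 := by
      rw [← Complex.normSq_eq_norm_sq, ← Complex.normSq_eq_norm_sq, Complex.normSq_sub]
      simp
      ring
    rw [hexp]
    by_cases h0 : z = 0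
    · subst h0
      simp [herm_eq_inner, lineProj]
    have hzn : ‖z‖ ≠ 0 := norm_ne_zero_iff.2 h0
    have hznC : (‖z‖ : ℂ) ≠ 0 := by exact_mod_cast hzn
    set h := herm w z with hh
    set y := w - lineProj z w with hy
    have hperp : herm y z = 0 := by
      rw [hy, herm_sub_left, lineProj, herm_smul_left, herm_self]
      field_simp
      simp
    have hy2 : ‖y‖ ^ 2 = ‖w‖ ^ 2 - ‖h‖ ^ 2 / ‖z‖ ^ 2 := by
      have hw' : w = y + (h / (‖z‖ : ℂ) ^ 2) • z := by
        rw [hy, lineProj]; simp [hh]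
      have : ‖w‖ ^ 2 = ‖y‖ ^ 2 + ‖(h / (‖z‖ : ℂ) ^ 2) • z‖ ^ 2 := by
        conv_lhs => rw [hw']
        have := norm_add_sq_eq_norm_sq_add_norm_sq_of_inner_eq_zero (𝕜 := ℂ) y
          ((h / (‖z‖ : ℂ) ^ 2) • z) (by
            rw [← herm_eq_inner, herm_smul_left, herm_eq_inner, ← inner_conj_symm,
              ← herm_eq_inner, hperp]
            simp)
        simpa [sq] using this
      rw [this, norm_smul, norm_div, norm_pow, Complex.norm_real, norm_norm]
      field_simp
      ring
    have hx : z - lineProj z w = (1 - h / (‖z‖ : ℂ) ^ 2) • z := by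
      rw [lineProj, sub_smul, one_smul]
    have hx2 : ‖z - lineProj z w‖ ^ 2 = ‖z‖ ^ 2 - 2 * h.re + ‖h‖ ^ 2 / ‖z‖ ^ 2 := by
      rw [hx, norm_smul, mul_pow]
      have : ‖(1 : ℂ) - h / (‖z‖ : ℂ) ^ 2‖ ^ 2 =
          1 - 2 * (h.re / ‖z‖ ^ 2) + ‖h‖ ^ 2 / ‖z‖ ^ 4 := by
        rw [← Complex.normSq_eq_norm_sq, Complex.normSq_sub, ← Complex.ofReal_pow,
          Complex.normSq_div, Complex.normSq_ofReal, ← Complex.normSq_eq_norm_sq]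
        simp only [map_one, one_mul, Complex.conj_re, map_div₀,
          Complex.conj_ofReal, Complex.div_ofReal_re]
        ring
      rw [this]
      field_simp
    have hpy := norm_add_sq_eq_norm_sq_add_norm_sq_of_inner_eq_zero (𝕜 := ℂ) (z - lineProj z w)
      (-(((Real.sqrt (1 - ‖z‖ ^ 2) : ℝ) : ℂ) • y)) (by
        rw [hx, inner_smul_left, inner_neg_right, inner_smul_right, ← herm_eq_inner, hperp]
        simp)
    rw [← sub_eq_add_neg, norm_neg, norm_smul, Complex.norm_real,
      Real.norm_of_nonneg (Real.sqrt_nonneg _)] at hpy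
    have hs := Real.sq_sqrt hz'.le
    have : ‖z - lineProj z w - ((Real.sqrt (1 - ‖z‖ ^ 2) : ℝ) : ℂ) • y‖ ^ 2 =
        ‖z - lineProj z w‖ ^ 2 + (1 - ‖z‖ ^ 2) * ‖y‖ ^ 2 := by
      rw [sq, hpy]
      linear_combination ‖y‖ ^ 2 * hs
    rw [this, hx2, hy2]
    field_simp
    ring
  rw [involution, norm_smul, mul_pow, hnum, norm_inv]
  field_simp

/-- The Bergman metric ball in terms of `|1 - ⟨w, z⟩|`. -/
theorem mem_bergmanMetricBall_iff {n : ℕ} {z w : Cn n} {γ : ℝ} (hz : z ∈ unitBall n)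
    (hγ : 0 < γ) : w ∈ bergmanMetricBall z γ ↔ w ∈ unitBall n ∧
      ‖1 - herm w z‖ ^ 2 < Real.cosh γ ^ 2 * ((1 - ‖z‖ ^ 2) * (1 - ‖w‖ ^ 2)) := by
  refine and_congr_right fun hw => ?_
  have hz' := mem_unitBall_iff.1 hz
  have hw' := mem_unitBall_iff.1 hw
  have hpos : 0 < ‖1 - herm w z‖ := by
    have := one_sub_norm_sq_le hw hz
    linarith
  have key := norm_involution_sq_mul hz hw
  set x := ‖involution z w‖ with hx
  have hx0 : 0 ≤ x := norm_nonneg _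
  have hx1 : x < 1 := by
    have : x ^ 2 * ‖1 - herm w z‖ ^ 2 < 1 * ‖1 - herm w z‖ ^ 2 := by
      rw [key]; nlinarith [mul_pos hz' hw']
    have := lt_of_mul_lt_mul_right this (by positivity)
    nlinarith
  have hc := Real.cosh_pos γ
  have hs : 0 < Real.sinh γ := Real.sinh_pos_iff.2 hγ
  have hcs := Real.cosh_sq γ
  have hcs' : 0 < Real.cosh γ - Real.sinh γ := by rw [Real.cosh_sub_sinh]; positivity
  have hexp : Real.exp (2 * γ) = (Real.cosh γ + Real.sinh γ) / (Real.cosh γ - Real.sinh γ) := by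
    rw [Real.cosh_add_sinh, Real.cosh_sub_sinh, ← Real.exp_sub]
    ring_nf
  -- β(z, w) < γ means |φ_z(w)| < tanh γ; squaring and using 1 - tanh² γ = 1 / cosh² γ gives the
  -- stated form.
  have h1 : bergmanDist z w < γ ↔ (1 + x) / (1 - x) < Real.exp (2 * γ) := by
    rw [← Real.log_lt_iff_lt_exp (div_pos (by linarith) (by linarith)), bergmanDist, ← hx]
    constructor <;> intro h <;> linarith
  have h2 : (1 + x) / (1 - x) < Real.exp (2 * γ) ↔ Real.cosh γ * x < Real.sinh γ := by
    rw [hexp, div_lt_div_iff₀ (by linarith) hcs']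
    constructor <;> intro h <;> nlinarith
  have h3 : Real.cosh γ * x < Real.sinh γ ↔ Real.cosh γ ^ 2 * x ^ 2 < Real.sinh γ ^ 2 := by
    rw [← mul_pow, sq_lt_sq₀ (by positivity) hs.le]
  have h4 : Real.cosh γ ^ 2 * x ^ 2 < Real.sinh γ ^ 2 ↔
      Real.cosh γ ^ 2 * x ^ 2 * ‖1 - herm w z‖ ^ 2 < Real.sinh γ ^ 2 * ‖1 - herm w z‖ ^ 2 :=
    (mul_lt_mul_iff_left₀ (by positivity)).symm
  rw [h1, h2, h3, h4, mul_assoc, key]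
  constructor <;> intro h <;> nlinarith

/-! ### Ellipsoids: geometry and volume -/

/-- The anisotropic ellipsoid of size `r` about `w`: its radius is `r (1 - |w|²)` in the direction
of `w` and `r (1 - |w|²)^{1/2}` in the orthogonal directions, up to bounded factors. -/
def ellipsoid {n : ℕ} (w : Cn n) (r : ℝ) : Set (Cn n) :=
  {z | ‖z - w‖ ^ 2 * (1 - ‖w‖ ^ 2) + ‖herm (z - w) w‖ ^ 2 < (r * (1 - ‖w‖ ^ 2)) ^ 2}

theorem isOpen_ellipsoid {n : ℕ} (w : Cn n) (r : ℝ) : IsOpen (ellipsoid w r) :=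
  isOpen_lt (by fun_prop) (by fun_prop)

theorem ellipsoid_circular {n : ℕ} {w : Cn n} (hw : w ∈ unitBall n) {r : ℝ} {x : Cn n}
    (hx : x ∈ ellipsoid w r) {c : ℂ} (hc : ‖c‖ ≤ 1) : w + c • (x - w) ∈ ellipsoid w r := by
  rw [mem_unitBall_iff] at hw
  refine lt_of_le_of_lt ?_ (show _ < (r * (1 - ‖w‖ ^ 2)) ^ 2 from hx)
  rw [add_sub_cancel_left, herm_smul_left, norm_smul, norm_mul]
  gcongr <;> exact mul_le_of_le_one_left (norm_nonneg _) hc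

/-- With σ = 1 - |w|², membership gives |⟨u - w, w⟩| ≤ σ/4 and |u - w|² ≤ σ/16. Expanding, 1 - |u|²
= σ - 2 Re⟨u - w, w⟩ - |u - w|² ≥ 7σ/16, which also puts u in the ball. -/
theorem ellipsoid_estimates {n : ℕ} {w u : Cn n} (hw : w ∈ unitBall n)
    (hu : u ∈ ellipsoid w (1 / 4)) :
    u ∈ unitBall n ∧ ‖1 - herm u w‖ ≤ 5 / 4 * (1 - ‖w‖ ^ 2) ∧
      1 - ‖w‖ ^ 2 ≤ 4 * (1 - ‖u‖ ^ 2) ∧ 1 - ‖u‖ ^ 2 ≤ 5 / 2 * (1 - ‖w‖ ^ 2) := by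
  have hw' := mem_unitBall_iff.1 hw
  set σ := 1 - ‖w‖ ^ 2 with hσ
  have hu' : ‖u - w‖ ^ 2 * σ + ‖herm (u - w) w‖ ^ 2 < (1 / 4 * σ) ^ 2 := hu
  have h1 : ‖herm (u - w) w‖ ≤ 1 / 4 * σ :=
    abs_le_of_sq_le_sq' (by nlinarith [mul_nonneg (sq_nonneg ‖u - w‖) hw'.le]) (by positivity) |>.2
  have h2 : ‖u - w‖ ^ 2 ≤ 1 / 16 * σ := by
    refine le_of_mul_le_mul_right ?_ hw'
    nlinarith [sq_nonneg ‖herm (u - w) w‖]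
  have h3 : 1 - herm u w = (σ : ℂ) - herm (u - w) w := by
    rw [herm_sub_left, herm_self, hσ]
    push_cast
    ring
  have h4 : ‖1 - herm u w‖ ≤ 5 / 4 * σ := by
    rw [h3]
    refine (norm_sub_le _ _).trans ?_
    rw [Complex.norm_real, Real.norm_of_nonneg hw'.le]
    linarith
  have h5 : 1 - ‖u‖ ^ 2 = σ - 2 * (herm (u - w) w).re - ‖u - w‖ ^ 2 := by
    rw [norm_sub_sq_eq, herm_sub_left, herm_self, hσ, Complex.sub_re, ← Complex.ofReal_pow,
      Complex.ofReal_re]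
    ring
  have h6 := Complex.re_le_norm (herm (u - w) w)
  have h7 : σ ≤ 4 * (1 - ‖u‖ ^ 2) := by linarith
  have hu'' : u ∈ unitBall n := mem_unitBall_iff.2 (by linarith)
  exact ⟨hu'', h4, h7, by linarith [one_sub_norm_sq_le hu'' hw]⟩

/-- Bounds the set of z near a fixed u once the order of integration is exchanged. The size C + 2
works because 2C + (C + 1)² < (C + 2)². -/
theorem mem_ellipsoid_of_norm_le {n : ℕ} {z u : Cn n} (hz : z ∈ unitBall n) (hu : u ∈ unitBall n)
    {C : ℝ} (h : ‖1 - herm z u‖ ≤ C * (1 - ‖u‖ ^ 2)) : z ∈ ellipsoid u (C + 2) := by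
  have hu' := mem_unitBall_iff.1 hu
  set σ := 1 - ‖u‖ ^ 2 with hσ
  have h1 : herm (z - u) u = (σ : ℂ) - (1 - herm z u) := by
    rw [herm_sub_left, herm_self, hσ]
    push_cast
    ring
  have h2 : ‖herm (z - u) u‖ ≤ (C + 1) * σ := by
    rw [h1]
    refine (norm_sub_le _ _).trans ?_
    rw [Complex.norm_real, Real.norm_of_nonneg hu'.le]
    linarith
  have h3 : ‖z - u‖ ^ 2 ≤ 2 * (C * σ) := (norm_sub_sq_le hz hu).trans (by linarith)
  have hC : 0 ≤ C := nonneg_of_mul_nonneg_left ((norm_nonneg _).trans h) hu'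
  change ‖z - u‖ ^ 2 * σ + ‖herm (z - u) u‖ ^ 2 < ((C + 2) * σ) ^ 2
  have h4 : ‖herm (z - u) u‖ ^ 2 ≤ ((C + 1) * σ) ^ 2 := by gcongr
  have h5 : ‖z - u‖ ^ 2 * σ ≤ 2 * (C * σ) * σ := by gcongr
  nlinarith [mul_pos hu' hu']

theorem det_transvection_innerSL {n : ℕ} (w : Cn n) (c : ℂ) :
    LinearMap.det (LinearMap.transvection (c • (innerSL ℂ w).toLinearMap : Module.Dual ℂ (Cn n)) w) =
      1 + c * (‖w‖ : ℂ) ^ 2 := by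
  rw [LinearMap.transvection.det]
  simp [inner_self_eq_norm_sq_to_K]

/-- The volume of an ellipsoid, which up to translation is a linear image of the unit ball. -/
theorem volume_ellipsoid {n : ℕ} {w : Cn n} (hw : w ∈ unitBall n) {r : ℝ} (hr : 0 < r) :
    volume (ellipsoid w r) =
      ENNReal.ofReal (r ^ (2 * n) * (1 - ‖w‖ ^ 2) ^ (n + 1)) * volume (unitBall n) := by
  have hw' := mem_unitBall_iff.1 hw
  set σ := 1 - ‖w‖ ^ 2 with hσ
  set s := Real.sqrt σ with hs
  have hs0 : 0 < s := Real.sqrt_pos.2 hw'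
  have hs2 : s ^ 2 = σ := Real.sq_sqrt hw'.le
  -- The map y ↦ y + d⟨y, w⟩w should stretch by 1/s along w and fix the orthogonal complement. This
  -- d is (1/s - 1)/|w|² with the factor 1 - s = |w|²/(1 + s) cancelled, so w = 0 needs no separate
  -- case.
  set d : ℝ := 1 / (s * (1 + s)) with hd
  have hd1 : 1 + d * ‖w‖ ^ 2 = 1 / s := by
    have : ‖w‖ ^ 2 = 1 - s ^ 2 := by rw [hs2, hσ]; ring
    rw [this, hd]
    field_simp
    ring
  set T : Cn n →ₗ[ℂ] Cn n := ((r * s)⁻¹ : ℂ) •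
    LinearMap.transvection ((d : ℂ) • (innerSL ℂ w).toLinearMap : Module.Dual ℂ (Cn n)) w with hT
  have hTapp : ∀ y, T y = ((r * s)⁻¹ : ℂ) • (y + ((d : ℂ) * herm y w) • w) := fun y => by
    simp [hT, LinearMap.transvection, herm_eq_inner]
  -- The real determinant is the squared modulus of the complex one, (rs)^(-n) · s⁻¹; the extra s⁻¹
  -- from the direction of w turns the exponent n into n + 1.
  have hdet : LinearMap.det (T.restrictScalars ℝ) = (r ^ (2 * n) * σ ^ (n + 1))⁻¹ := by
    rw [LinearMap.det_restrictScalars, hT, LinearMap.det_smul, det_transvection_innerSL,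
      finrank_euclideanSpace_fin]
    have h1 : ((r * s : ℂ)⁻¹) ^ n * (1 + d * (‖w‖ : ℂ) ^ 2) =
        (((r * s)⁻¹ ^ n * (1 / s) : ℝ) : ℂ) := by
      rw [← hd1]; push_cast; ring
    rw [h1, Algebra.norm_complex_apply, Complex.normSq_ofReal, ← hs2, one_div, inv_pow, ← mul_inv,
      ← mul_inv]
    congr 1
    ring
  have hTn : ∀ y, ‖T y‖ ^ 2 = (‖y‖ ^ 2 * σ + ‖herm y w‖ ^ 2) / (r * σ) ^ 2 := fun y => by
    have h1 : ‖y + ((d : ℂ) * herm y w) • w‖ ^ 2 =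
        ‖y‖ ^ 2 + (2 * d + d ^ 2 * ‖w‖ ^ 2) * ‖herm y w‖ ^ 2 := by
      rw [@norm_add_sq ℂ, inner_smul_right, norm_smul, norm_mul, Complex.norm_real,
        Real.norm_of_nonneg (by positivity), ← inner_conj_symm, ← herm_eq_inner, mul_assoc,
        Complex.mul_conj, Complex.normSq_eq_norm_sq]
      simp only [← Complex.ofReal_mul, RCLike.re_to_complex, Complex.ofReal_re]
      ring
    have h2 : (2 * d + d ^ 2 * ‖w‖ ^ 2) = 1 / σ := by
      have : ‖w‖ ^ 2 = 1 - s ^ 2 := by rw [hs2, hσ]; ring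
      rw [this, hd, ← hs2]
      field_simp
      ring
    rw [hTapp, norm_smul, mul_pow, h1, h2, norm_inv, ← Complex.ofReal_mul, Complex.norm_real,
      Real.norm_of_nonneg (by positivity), inv_pow, mul_pow, hs2]
    field_simp
  have hset : ellipsoid w r = (fun z => z - w) ⁻¹' ((T.restrictScalars ℝ) ⁻¹' unitBall n) := by
    ext z
    rw [Set.mem_preimage, Set.mem_preimage, LinearMap.restrictScalars_apply, mem_unitBall_iff,
      sub_pos, hTn, div_lt_one (by positivity)]
    rfl
  have hopen : MeasurableSet ((T.restrictScalars ℝ) ⁻¹' unitBall n) :=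
    (Metric.isOpen_ball.preimage
      (LinearMap.continuous_of_finiteDimensional (T.restrictScalars ℝ))).measurableSet
  rw [hset, (measurePreserving_sub_right volume w).measure_preimage hopen.nullMeasurableSet,
    Measure.addHaar_preimage_linearMap _ (by rw [hdet]; positivity), hdet, inv_inv,
    abs_of_pos (by positivity)]

/-! ### Comparability of nearby points -/

/-- Pairs of points of the ball at bounded Bergman distance, in terms of `|1 - ⟨z, u⟩|`. -/
def nearPairs (n : ℕ) (C : ℝ) : Set (Cn n × Cn n) :=
  {q | ‖1 - herm q.1 q.2‖ ≤ C * (1 - ‖q.2‖ ^ 2) ∧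
    1 - ‖q.2‖ ^ 2 ≤ C * (1 - ‖q.1‖ ^ 2) ∧ 1 - ‖q.1‖ ^ 2 ≤ C * (1 - ‖q.2‖ ^ 2)}

theorem measurableSet_nearPairs (n : ℕ) (C : ℝ) : MeasurableSet (nearPairs n C) := by
  have h1 : IsClosed {q : Cn n × Cn n | ‖1 - herm q.1 q.2‖ ≤ C * (1 - ‖q.2‖ ^ 2)} :=
    isClosed_le (by fun_prop) (by fun_prop)
  have h2 : IsClosed {q : Cn n × Cn n | 1 - ‖q.2‖ ^ 2 ≤ C * (1 - ‖q.1‖ ^ 2)} :=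
    isClosed_le (by fun_prop) (by fun_prop)
  have h3 : IsClosed {q : Cn n × Cn n | 1 - ‖q.1‖ ^ 2 ≤ C * (1 - ‖q.2‖ ^ 2)} :=
    isClosed_le (by fun_prop) (by fun_prop)
  exact (h1.inter (h2.inter h3)).measurableSet

theorem mem_nearPairs {n : ℕ} {γ : ℝ} (hγ : 0 < γ) {z w u : Cn n} (hz : z ∈ unitBall n)
    (hw : w ∈ bergmanMetricBall z γ) (hu : u ∈ ellipsoid w (1 / 4)) :
    (z, u) ∈ nearPairs n (52 * Real.cosh γ ^ 2) := by
  obtain ⟨hwB, hwz⟩ := (mem_bergmanMetricBall_iff hz hγ).1 hw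
  obtain ⟨huB, h1, h2, h3⟩ := ellipsoid_estimates hwB hu
  have hz' := mem_unitBall_iff.1 hz
  have hw' := mem_unitBall_iff.1 hwB
  have hu' := mem_unitBall_iff.1 huB
  have h4 := one_sub_norm_sq_le hwB hz
  have h5 := one_sub_norm_sq_le hz hwB
  rw [norm_one_sub_herm_comm] at h5
  have h6 := norm_one_sub_herm_le hz huB hwB
  rw [norm_one_sub_herm_comm z w, norm_one_sub_herm_comm w u] at h6
  have hK : 1 ≤ Real.cosh γ ^ 2 := one_le_pow₀ (Real.one_le_cosh γ)
  set K := Real.cosh γ ^ 2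
  set σz := 1 - ‖z‖ ^ 2
  set σw := 1 - ‖w‖ ^ 2
  set σu := 1 - ‖u‖ ^ 2
  set δ := ‖1 - herm w z‖
  -- Both σz and σw are at most 2δ, while δ² < K σz σw; hence σz and σw are comparable and δ ≤ 2Kσw.
  -- The quasi-triangle inequality through w then gives 4(2K + 5/4)σw ≤ 13Kσw ≤ 52Kσu, the source of
  -- 52.
  have h7 : σz ≤ 4 * K * σw := by
    refine le_of_mul_le_mul_left ?_ hz'
    nlinarith
  have h8 : σw ≤ 4 * K * σz := by
    refine le_of_mul_le_mul_left ?_ hw'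
    nlinarith
  have h9 : δ ≤ 2 * K * σw := by
    refine abs_le_of_sq_le_sq' ?_ (by positivity) |>.2
    nlinarith [mul_le_mul_of_nonneg_right h7 (by positivity : 0 ≤ K * σw)]
  have hKw : σw ≤ K * σw := le_mul_of_one_le_left hw'.le hK
  have hKu : K * σw ≤ K * (4 * σu) := by gcongr
  have hKz : 0 < K * σz := by positivity
  refine ⟨?_, ?_, ?_⟩
  · change ‖1 - herm z u‖ ≤ 52 * K * σu
    linarith
  · change σu ≤ 52 * K * σz
    linarith
  · change σz ≤ 52 * K * σu
    nlinarith [mul_pos (by positivity : 0 < K) hu']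

/-- For α < 0 the power reverses inequalities, so each sign of α uses a different one of the two
comparisons. -/
theorem rpow_le_const_mul_rpow {x y C : ℝ} (hx : 0 < x) (hy : 0 < y) (hC : 0 < C)
    (hxy : x ≤ C * y) (hyx : y ≤ C * x) (α : ℝ) : x ^ α ≤ C ^ |α| * y ^ α := by
  rcases le_total 0 α with hα | hα
  · rw [abs_of_nonneg hα, ← Real.mul_rpow hC.le hy.le]
    exact Real.rpow_le_rpow hx.le hxy hα
  · have h := Real.rpow_le_rpow_of_nonpos hy hyx hα
    rw [Real.mul_rpow hC.le hx.le] at h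
    rw [abs_of_nonpos hα, Real.rpow_neg hC.le]
    rwa [inv_mul_eq_div, le_div_iff₀' (by positivity)]

theorem volume_unitBall_ne_zero (n : ℕ) : volume (unitBall n) ≠ 0 :=
  (Metric.measure_ball_pos volume 0 one_pos).ne'

theorem volume_unitBall_ne_top (n : ℕ) : volume (unitBall n) ≠ ∞ :=
  measure_ball_lt_top.ne

/-- The volume of an ellipsoid of fixed size is comparable to a power of `1 - |u|²` for any
of its points `u`. -/
theorem const_mul_le_volume_ellipsoid {n : ℕ} {w u : Cn n} (hw : w ∈ unitBall n)
    (hu : u ∈ ellipsoid w (1 / 4)) :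
    (ENNReal.ofReal ((1 / 4) ^ (2 * n) * (2 / 5) ^ (n + 1)) * volume (unitBall n)) *
      ENNReal.ofReal ((1 - ‖u‖ ^ 2) ^ (n + 1)) ≤ volume (ellipsoid w (1 / 4)) := by
  obtain ⟨huB, -, -, h3⟩ := ellipsoid_estimates hw hu
  have hu' := mem_unitBall_iff.1 huB
  rw [volume_ellipsoid hw (by norm_num), mul_right_comm, ← ENNReal.ofReal_mul (by positivity),
    mul_assoc ((1 / 4 : ℝ) ^ (2 * n)), ← mul_pow]
  gcongr
  linarith

/-! ### The integral bound for the maximal function -/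

/-- The weighted pointwise bound of the maximal function by an integral over nearby points. -/
theorem maximalFunction_rpow_mul_le (n : ℕ) {γ p : ℝ} (α : ℝ) (hγ : 0 < γ) (hp : 0 < p) :
    ∃ A : ℝ≥0∞, A ≠ ∞ ∧ ∀ f ∈ holomorphic n, ∀ z ∈ unitBall n,
      maximalFunction γ f z ^ p * ENNReal.ofReal ((1 - ‖z‖ ^ 2) ^ α) ≤
        ∫⁻ u in unitBall n, (nearPairs n (52 * Real.cosh γ ^ 2)).indicator
          (fun q => A * (‖f q.2‖ₑ ^ p * ENNReal.ofReal ((1 - ‖q.2‖ ^ 2) ^ α)) *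
            (ENNReal.ofReal ((1 - ‖q.2‖ ^ 2) ^ (n + 1)))⁻¹) (z, u) := by
  set C := 52 * Real.cosh γ ^ 2 with hC
  have hC0 : 0 < C := by have := Real.cosh_pos γ; positivity
  set B : ℝ≥0∞ :=
    ENNReal.ofReal ((1 / 4) ^ (2 * n) * (2 / 5) ^ (n + 1)) * volume (unitBall n) with hB
  have hB0 : B ≠ 0 :=
    mul_ne_zero (by rw [Ne, ENNReal.ofReal_eq_zero, not_le]; positivity)
      (volume_unitBall_ne_zero n)
  have hBt : B ≠ ∞ := ENNReal.mul_ne_top ENNReal.ofReal_ne_top (volume_unitBall_ne_top n)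
  refine ⟨ENNReal.ofReal (C ^ |α|) * B⁻¹,
    ENNReal.mul_ne_top ENNReal.ofReal_ne_top (ENNReal.inv_ne_top.2 hB0), fun f hf z hz => ?_⟩
  have hz' := mem_unitBall_iff.1 hz
  set I := ∫⁻ u in unitBall n, (nearPairs n C).indicator
    (fun q => ENNReal.ofReal (C ^ |α|) * B⁻¹ *
      (‖f q.2‖ₑ ^ p * ENNReal.ofReal ((1 - ‖q.2‖ ^ 2) ^ α)) *
      (ENNReal.ofReal ((1 - ‖q.2‖ ^ 2) ^ (n + 1)))⁻¹) (z, u)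
  have hσ0 : ENNReal.ofReal ((1 - ‖z‖ ^ 2) ^ α) ≠ 0 := by
    rw [Ne, ENNReal.ofReal_eq_zero, not_le]; positivity
  -- I does not depend on w, so after dividing by the weight and taking p-th roots the bound passes
  -- to the supremum.
  suffices h : ∀ w ∈ bergmanMetricBall z γ,
      ‖f w‖ₑ ^ p * ENNReal.ofReal ((1 - ‖z‖ ^ 2) ^ α) ≤ I by
    rw [← ENNReal.le_div_iff_mul_le (Or.inl hσ0) (Or.inl ENNReal.ofReal_ne_top),
      ← ENNReal.le_rpow_inv_iff hp]
    refine iSup₂_le fun w hw => ?_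
    rw [ENNReal.le_rpow_inv_iff hp,
      ENNReal.le_div_iff_mul_le (Or.inl hσ0) (Or.inl ENNReal.ofReal_ne_top)]
    exact h w hw
  intro w hw
  have hwB : w ∈ unitBall n := hw.1
  have hw' := mem_unitBall_iff.1 hwB
  set E := ellipsoid w (1 / 4) with hE
  have hEB : E ⊆ unitBall n := fun u hu => (ellipsoid_estimates hwB hu).1
  have hEm : MeasurableSet E := (isOpen_ellipsoid w _).measurableSet
  have hVt : volume E ≠ ∞ := ((measure_mono hEB).trans_lt measure_ball_lt_top).ne
  have hV0 : volume E ≠ 0 := by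
    rw [hE, volume_ellipsoid hwB (by norm_num)]
    exact mul_ne_zero (by rw [Ne, ENNReal.ofReal_eq_zero, not_le]; positivity)
      (volume_unitBall_ne_zero n)
  have hsub := rpow_enorm_mul_volume_le hp Metric.isOpen_ball hf hEm hEB
    fun x hx c hc => ellipsoid_circular hwB hx hc
  calc ‖f w‖ₑ ^ p * ENNReal.ofReal ((1 - ‖z‖ ^ 2) ^ α)
      = ‖f w‖ₑ ^ p * volume E * ((volume E)⁻¹ * ENNReal.ofReal ((1 - ‖z‖ ^ 2) ^ α)) := by
        rw [mul_assoc, ← mul_assoc (volume E), ENNReal.mul_inv_cancel hV0 hVt, one_mul]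
    _ ≤ (∫⁻ x in E, ‖f x‖ₑ ^ p) * ((volume E)⁻¹ * ENNReal.ofReal ((1 - ‖z‖ ^ 2) ^ α)) := by
        gcongr
    _ = ∫⁻ x in E, ‖f x‖ₑ ^ p * ((volume E)⁻¹ * ENNReal.ofReal ((1 - ‖z‖ ^ 2) ^ α)) :=
        (lintegral_mul_const' _ _ (ENNReal.mul_ne_top (ENNReal.inv_ne_top.2 hV0)
          ENNReal.ofReal_ne_top)).symm
    _ ≤ ∫⁻ u in E, (nearPairs n C).indicator
          (fun q => ENNReal.ofReal (C ^ |α|) * B⁻¹ *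
            (‖f q.2‖ₑ ^ p * ENNReal.ofReal ((1 - ‖q.2‖ ^ 2) ^ α)) *
            (ENNReal.ofReal ((1 - ‖q.2‖ ^ 2) ^ (n + 1)))⁻¹) (z, u) := by
        refine setLIntegral_mono' hEm fun u hu => ?_
        have hnear := mem_nearPairs hγ hz hw hu
        rw [Set.indicator_of_mem hnear]
        have hu' := mem_unitBall_iff.1 (hEB hu)
        have h1 : ENNReal.ofReal ((1 - ‖z‖ ^ 2) ^ α) ≤
            ENNReal.ofReal (C ^ |α|) * ENNReal.ofReal ((1 - ‖u‖ ^ 2) ^ α) := by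
          rw [← ENNReal.ofReal_mul (by positivity)]
          exact ENNReal.ofReal_le_ofReal
            (rpow_le_const_mul_rpow hz' hu' hC0 hnear.2.2 hnear.2.1 α)
        have h2 : (volume E)⁻¹ ≤ B⁻¹ * (ENNReal.ofReal ((1 - ‖u‖ ^ 2) ^ (n + 1)))⁻¹ := by
          rw [← ENNReal.mul_inv (Or.inl hB0) (Or.inl hBt)]
          exact ENNReal.inv_le_inv.2 (const_mul_le_volume_ellipsoid hwB hu)
        calc ‖f u‖ₑ ^ p * ((volume E)⁻¹ * ENNReal.ofReal ((1 - ‖z‖ ^ 2) ^ α))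
            ≤ ‖f u‖ₑ ^ p * ((B⁻¹ * (ENNReal.ofReal ((1 - ‖u‖ ^ 2) ^ (n + 1)))⁻¹) *
              (ENNReal.ofReal (C ^ |α|) * ENNReal.ofReal ((1 - ‖u‖ ^ 2) ^ α))) := by gcongr
          _ = _ := by ring
    _ ≤ I := lintegral_mono_set hEB

/-- Integration of the bound for the maximal function over the ball. -/
theorem lintegral_maximalFunction_rpow_le (n : ℕ) {γ p : ℝ} (α : ℝ) (hγ : 0 < γ) (hp : 0 < p) :
    ∃ A : ℝ≥0∞, A ≠ ∞ ∧ ∀ f ∈ holomorphic n,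
      ∫⁻ z in unitBall n, maximalFunction γ f z ^ p * ENNReal.ofReal ((1 - ‖z‖ ^ 2) ^ α) ≤
        A * ∫⁻ u in unitBall n, ‖f u‖ₑ ^ p * ENNReal.ofReal ((1 - ‖u‖ ^ 2) ^ α) := by
  obtain ⟨A, hA, hbound⟩ := maximalFunction_rpow_mul_le n α hγ hp
  set C := 52 * Real.cosh γ ^ 2 with hC
  have hC0 : 0 < C := by have := Real.cosh_pos γ; positivity
  have hBm : MeasurableSet (unitBall n) := Metric.isOpen_ball.measurableSet
  set D : ℝ≥0∞ := ENNReal.ofReal ((C + 2) ^ (2 * n)) * volume (unitBall n) with hD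
  refine ⟨A * D, ENNReal.mul_ne_top hA (ENNReal.mul_ne_top ENNReal.ofReal_ne_top
    (volume_unitBall_ne_top n)), fun f hf => ?_⟩
  -- Nothing is known of f off the ball; cutting off by zero makes the kernel jointly measurable, as
  -- Tonelli requires.
  set G : Cn n → ℝ≥0∞ := (unitBall n).indicator fun u => ‖f u‖ₑ ^ p with hG
  have hGm : Measurable G := measurable_indicator_rpow_enorm p hBm hf.continuousOn
  set Φ : Cn n → ℝ≥0∞ := fun u => A * (G u * ENNReal.ofReal ((1 - ‖u‖ ^ 2) ^ α)) *
    (ENNReal.ofReal ((1 - ‖u‖ ^ 2) ^ (n + 1)))⁻¹ with hΦ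
  have hΦm : Measurable Φ := by fun_prop
  have hker : ∀ z u, u ∈ unitBall n → (nearPairs n C).indicator
      (fun q => A * (‖f q.2‖ₑ ^ p * ENNReal.ofReal ((1 - ‖q.2‖ ^ 2) ^ α)) *
        (ENNReal.ofReal ((1 - ‖q.2‖ ^ 2) ^ (n + 1)))⁻¹) (z, u) =
      (nearPairs n C).indicator (fun q => Φ q.2) (z, u) := fun z u hu => by
    by_cases hzu : (z, u) ∈ nearPairs n C
    · rw [Set.indicator_of_mem hzu, Set.indicator_of_mem hzu]
      simp only [hΦ, hG, Set.indicator_of_mem hu]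
    · rw [Set.indicator_of_notMem hzu, Set.indicator_of_notMem hzu]
  have hmeas : Measurable (Function.uncurry fun z u =>
      (nearPairs n C).indicator (fun q => Φ q.2) (z, u)) :=
    (hΦm.comp measurable_snd).indicator (measurableSet_nearPairs n C)
  calc ∫⁻ z in unitBall n, maximalFunction γ f z ^ p * ENNReal.ofReal ((1 - ‖z‖ ^ 2) ^ α)
      ≤ ∫⁻ z in unitBall n, ∫⁻ u in unitBall n,
          (nearPairs n C).indicator (fun q => Φ q.2) (z, u) := by
        refine setLIntegral_mono' hBm fun z hz => (hbound f hf z hz).trans_eq ?_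
        exact setLIntegral_congr_fun hBm fun u hu => hker z u hu
    _ = ∫⁻ u in unitBall n, ∫⁻ z in unitBall n,
          (nearPairs n C).indicator (fun q => Φ q.2) (z, u) :=
        lintegral_lintegral_swap hmeas.aemeasurable
    _ ≤ ∫⁻ u in unitBall n,
          A * D * (‖f u‖ₑ ^ p * ENNReal.ofReal ((1 - ‖u‖ ^ 2) ^ α)) := by
        refine setLIntegral_mono' hBm fun u hu => ?_
        have hu' := mem_unitBall_iff.1 hu
        have hW0 : ENNReal.ofReal ((1 - ‖u‖ ^ 2) ^ (n + 1)) ≠ 0 := by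
          rw [Ne, ENNReal.ofReal_eq_zero, not_le]; positivity
        have hEm : MeasurableSet (ellipsoid u (C + 2)) := (isOpen_ellipsoid u _).measurableSet
        -- For fixed u the integrand is constant in z on its support, which lies in an ellipsoid
        -- about u of volume D (1 - |u|²)^(n+1); this power cancels the one in Φ.
        calc ∫⁻ z in unitBall n, (nearPairs n C).indicator (fun q => Φ q.2) (z, u)
            ≤ ∫⁻ z in unitBall n, (ellipsoid u (C + 2)).indicator (fun _ => Φ u) z := by
              refine setLIntegral_mono' hBm fun z hz => ?_
              by_cases hzu : (z, u) ∈ nearPairs n C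
              · rw [Set.indicator_of_mem hzu,
                  Set.indicator_of_mem (mem_ellipsoid_of_norm_le hz hu hzu.1)]
              · rw [Set.indicator_of_notMem hzu]
                exact zero_le
          _ ≤ ∫⁻ z, (ellipsoid u (C + 2)).indicator (fun _ => Φ u) z :=
              setLIntegral_le_lintegral _ _
          _ = Φ u * (ENNReal.ofReal ((1 - ‖u‖ ^ 2) ^ (n + 1)) * D) := by
              rw [lintegral_indicator hEm, setLIntegral_const, volume_ellipsoid hu (by positivity),
                ENNReal.ofReal_mul (by positivity), hD]
              ring
          _ = A * D * (‖f u‖ₑ ^ p * ENNReal.ofReal ((1 - ‖u‖ ^ 2) ^ α)) := by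
              simp only [hΦ, hG, Set.indicator_of_mem hu]
              rw [mul_assoc, ← mul_assoc _ _ D, ENNReal.inv_mul_cancel hW0 ENNReal.ofReal_ne_top]
              ring
    _ = A * D * ∫⁻ u in unitBall n, ‖f u‖ₑ ^ p * ENNReal.ofReal ((1 - ‖u‖ ^ 2) ^ α) :=
        lintegral_const_mul' _ _ (ENNReal.mul_ne_top hA (ENNReal.mul_ne_top ENNReal.ofReal_ne_top
          (volume_unitBall_ne_top n)))

/-! ### The weighted measure and measurability -/

/-- Integration against `dv_α` in terms of Lebesgue measure on the ball. -/
theorem lintegral_weightedMeasure (n : ℕ) (α : ℝ) (g : Cn n → ℝ≥0∞) :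
    ∫⁻ z, g z ∂(weightedMeasure n α) =
      (volume (unitBall n))⁻¹ * ENNReal.ofReal (weightConst n α) *
        ∫⁻ z in unitBall n, g z * ENNReal.ofReal ((1 - ‖z‖ ^ 2) ^ α) := by
  have hm : Measurable fun z : Cn n =>
      ENNReal.ofReal (weightConst n α * (1 - ‖z‖ ^ 2) ^ α) := by fun_prop
  -- The density is measurable and finite, which suffices for an arbitrary g.
  rw [weightedMeasure, lintegral_withDensity_eq_lintegral_mul_non_measurable _ hm
    (Filter.Eventually.of_forall fun _ => ENNReal.ofReal_lt_top), normalizedVolume,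
    lintegral_smul_measure, smul_eq_mul, mul_assoc,
    ← lintegral_const_mul' _ _ ENNReal.ofReal_ne_top]
  congr 1
  refine setLIntegral_congr_fun Metric.isOpen_ball.measurableSet fun z hz => ?_
  have hz' := mem_unitBall_iff.1 hz
  simp only [Pi.mul_apply]
  rw [ENNReal.ofReal_mul' (by positivity)]
  ring

theorem weightedMeasure_absolutelyContinuous (n : ℕ) (α : ℝ) :
    weightedMeasure n α ≪ volume.restrict (unitBall n) :=
  (withDensity_absolutelyContinuous _ _).trans Measure.smul_absolutelyContinuous

theorem mem_bergmanMetricBall_self {n : ℕ} {z : Cn n} {γ : ℝ} (hz : z ∈ unitBall n)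
    (hγ : 0 < γ) : z ∈ bergmanMetricBall z γ := by
  have h : ‖involution z z‖ ^ 2 * ‖1 - herm z z‖ ^ 2 = 0 := by
    rw [norm_involution_sq_mul hz hz, herm_self, ← Complex.ofReal_pow, ← Complex.ofReal_one,
      ← Complex.ofReal_sub, Complex.norm_real, Real.norm_eq_abs, sq_abs]
    ring
  have h1 := one_sub_norm_sq_le hz hz
  have h2 := mem_unitBall_iff.1 hz
  have h3 : ‖1 - herm z z‖ ≠ 0 := (by linarith : 0 < ‖1 - herm z z‖).ne'
  refine ⟨hz, ?_⟩
  have h4 : ‖involution z z‖ = 0 := by simpa [h3] using h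
  simpa [bergmanDist, h4] using hγ

theorem enorm_le_maximalFunction {n : ℕ} {γ : ℝ} (hγ : 0 < γ) (f : Cn n → ℂ) {z : Cn n}
    (hz : z ∈ unitBall n) : ‖f z‖ₑ ≤ maximalFunction γ f z :=
  le_iSup₂ (f := fun w (_ : w ∈ bergmanMetricBall z γ) => ‖f w‖ₑ) z
    (mem_bergmanMetricBall_self hz hγ)

/-- The maximal function is lower semicontinuous on the ball, hence measurable. -/
theorem aemeasurable_maximalFunction {n : ℕ} {γ : ℝ} (hγ : 0 < γ) (f : Cn n → ℂ) (α : ℝ) :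
    AEMeasurable (maximalFunction γ f) (weightedMeasure n α) := by
  have hBm : MeasurableSet (unitBall n) := Metric.isOpen_ball.measurableSet
  refine AEMeasurable.mono_ac ?_ (weightedMeasure_absolutelyContinuous n α)
  refine ⟨(unitBall n).indicator (maximalFunction γ f), ?_, ?_⟩
  · refine measurable_of_Ioi fun c => ?_
    -- Fixing w instead of z, the condition w ∈ D(z, γ) is open in z, so superlevel sets are unions
    -- of open sets, whatever f is.
    have hset : (unitBall n).indicator (maximalFunction γ f) ⁻¹' Set.Ioi c =
        ⋃ w ∈ {w : Cn n | w ∈ unitBall n ∧ c < ‖f w‖ₑ}, unitBall n ∩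
          {z | ‖1 - herm w z‖ ^ 2 < Real.cosh γ ^ 2 * ((1 - ‖z‖ ^ 2) * (1 - ‖w‖ ^ 2))} := by
      ext z
      simp only [Set.mem_preimage, Set.mem_Ioi, Set.mem_iUnion, Set.mem_inter_iff,
        Set.mem_ofPred_eq, exists_prop]
      by_cases hz : z ∈ unitBall n
      · rw [Set.indicator_of_mem hz, maximalFunction]
        simp only [lt_iSup_iff, mem_bergmanMetricBall_iff hz hγ, exists_prop, hz, true_and]
        exact exists_congr fun w => by tauto
      · rw [Set.indicator_of_notMem hz]
        simp [hz]
    rw [hset]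
    refine (isOpen_biUnion fun w _ => Metric.isOpen_ball.inter ?_).measurableSet
    exact isOpen_lt (by fun_prop) (by fun_prop)
  · filter_upwards [ae_restrict_mem hBm] with z hz
    rw [Set.indicator_of_mem hz]

theorem memLp_maximalFunction_iff {n : ℕ} {γ p : ℝ} (hγ : 0 < γ) (hp : 0 < p) (α : ℝ)
    (f : Cn n → ℂ) :
    MemLp (maximalFunction γ f) (ENNReal.ofReal p) (weightedMeasure n α) ↔
      weightedNorm p α (maximalFunction γ f) < ∞ := by
  rw [MemLp, and_iff_right (aemeasurable_maximalFunction hγ f α).aestronglyMeasurable,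
    eLpNorm_eq_lintegral_rpow_enorm_toReal (by simpa using hp) ENNReal.ofReal_ne_top,
    ENNReal.toReal_ofReal hp.le]
  rfl

theorem weightedNorm_le_weightedNorm_maximalFunction {n : ℕ} {γ p : ℝ} (hγ : 0 < γ) (hp : 0 < p)
    (α : ℝ) (f : Cn n → ℂ) :
    weightedNorm p α f ≤ weightedNorm p α (maximalFunction γ f) := by
  refine ENNReal.rpow_le_rpow (lintegral_mono_ae ?_) (by positivity)
  refine (weightedMeasure_absolutelyContinuous n α).ae_le ?_
  filter_upwards [ae_restrict_mem Metric.isOpen_ball.measurableSet] with z hz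
  exact ENNReal.rpow_le_rpow (enorm_le_maximalFunction hγ f hz) hp.le

theorem exists_weightedNorm_maximalFunction_le (n : ℕ) {γ p : ℝ} (α : ℝ) (hγ : 0 < γ)
    (hp : 0 < p) : ∃ C : ℝ≥0, ∀ f ∈ holomorphic n,
      weightedNorm p α (maximalFunction γ f) ≤ C * weightedNorm p α f := by
  obtain ⟨A, hA, h⟩ := lintegral_maximalFunction_rpow_le n α hγ hp
  refine ⟨(A ^ (1 / p)).toNNReal, fun f hf => ?_⟩
  rw [ENNReal.coe_toNNReal (ENNReal.rpow_ne_top_of_nonneg (by positivity) hA), weightedNorm,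
    weightedNorm, ← ENNReal.mul_rpow_of_nonneg _ _ (by positivity)]
  refine ENNReal.rpow_le_rpow ?_ (by positivity)
  -- The normalizing constants of dv_α appear as the same factor on both sides.
  rw [lintegral_weightedMeasure, lintegral_weightedMeasure, mul_left_comm]
  gcongr
  exact h f hf

end BergmanBall

end

theorem theorem1 (n : ℕ) (hn : 1 ≤ n) (γ α p : ℝ) (hγ : 0 < γ) (hα : -1 < α) (hp : 0 < p) :
    (∀ f ∈ BergmanBall.holomorphic n,
      (f ∈ BergmanBall.bergmanSpace n p α ↔
        MemLp (BergmanBall.maximalFunction γ f) (ENNReal.ofReal p)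
          (BergmanBall.weightedMeasure n α))) ∧
    ∃ C : ℝ≥0, 0 < C ∧ ∀ f ∈ BergmanBall.holomorphic n,
      BergmanBall.weightedNorm p α f ≤
        C * BergmanBall.weightedNorm p α (BergmanBall.maximalFunction γ f) ∧
      BergmanBall.weightedNorm p α (BergmanBall.maximalFunction γ f) ≤
        C * BergmanBall.weightedNorm p α f := by
  obtain ⟨C, hC⟩ := BergmanBall.exists_weightedNorm_maximalFunction_le n α hγ hp
  -- C + 1 is positive and at least 1, so it serves both inequalities.
  refine ⟨fun f hf => ?_, C + 1, by positivity, fun f hf => ⟨?_, ?_⟩⟩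
  · rw [BergmanBall.memLp_maximalFunction_iff hγ hp]
    exact ⟨fun h => (hC f hf).trans_lt (ENNReal.mul_lt_top ENNReal.coe_lt_top h.2), fun h =>
      ⟨hf, (BergmanBall.weightedNorm_le_weightedNorm_maximalFunction hγ hp α f).trans_lt h⟩⟩
  · refine (BergmanBall.weightedNorm_le_weightedNorm_maximalFunction hγ hp α f).trans ?_
    exact le_mul_of_one_le_left' (by simp)
  · refine (hC f hf).trans ?_
    gcongr
    simp
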